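/- Let $m\ge 1$, $[m]=\{1,\dots,m\}$, let $\mathbf k$ be a field, and let $f:2^{[m]}\to\mathbb Z/2$ be a function whose support $K_f=f^{-1}(1)$ is an abstract simplicial complex on $[m]$, i.e. $K_f$ is closed under taking subsets and $\bigcup_{a\in K_f}a=[m]$. Let $\mathbf k(K_f)=\mathbf k[v_1,\dots,v_m]/\langle \prod_{i\in\tau}v_i : \tau\subseteq[m],\ \tau\notin K_f\rangle$ be the Stanley–Reisner face ring with its $\mathbb N^m$-grading. Then $\mathbf k(K_f)$ has an $\mathbb N^m$-graded minimal free resolution of finite length over $\mathbf k[\mathbf v]=\mathbf k[v_1,\dots,v_m]$. Let $$0\leftarrow \mathbf k(K_f)\leftarrow F_0\leftarrow F_1\leftarrow\cdots\leftarrow F_h\leftarrow 0,\qquad F_i=\bigoplus_{\mathbf a\in\mathbb N^m}\mathbf k[\mathbf v](-\mathbf a)^{\beta_{i,\mathbf a}},\quad F_h\neq 0,$$ be any such resolution, where $\mathbf k[\mathbf v](-\mathbf a)$ is the free module of rank one generated in degree $\mathbf a$, all maps preserve degrees, and minimal means that each map $F_{i+1}\to F_i$ has image in $\langle v_1,\dots,v_m\rangle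 F_i$. For $a\subseteq[m]$ write $\beta_{i,a}^{\mathbf k(K_f)}=\beta_{i,\mathbf a}$, where $\mathbf a\in\{0,1\}^m$ is the indicator vector of $a$ (the Betti numbers of $\mathbf k(K_f)$). Then the Möbius transform $\mathcal M(f)(a)=\sum_{b\subseteq a}f(b)$ satisfies, as a $\mathbb Z/2$-valued function on $2^{[m]}$, $$\mathcal M(f)=\sum_{i=0}^{h}\sum_{a\in 2^{[m]}}\beta_{i,a}^{\mathbf k(K_f)}\,\delta_a ,$$ where $\delta_a(b)=1$ if $b=a$ and $\delta_a(b)=0$ otherwise. Equivalently, $\mathcal M(f)(a)\equiv\sum_{i=0}^h\beta_{i,a}^{\mathbf k(K_f)} \pmod 2$ for every $a\subseteq[m]$. -/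

import Mathlib

open MvPolynomial

noncomputable section

/-! ### Functions on the power set of `[m]` and the Möbius transform

The set `[m]` is modelled by `Fin m`, and `2^[m]` by `Finset (Fin m)`. -/

/-- The support `f⁻¹(1)` of a `ℤ/2`-valued function on `2^[m]`. -/
def suppComplex {m : ℕ} (f : Finset (Fin m) → ZMod 2) : Set (Finset (Fin m)) :=
  {a | f a = 1}

/-- `K` is an abstract simplicial complex on the vertex set `[m]`: a family of subsets of `[m]`,
closed under passing to subsets (including the empty one), whose union is all of `[m]`. -/
structure IsSimplicialComplexOn {m : ℕ} (K : Set (Finset (Fin m))) : Prop where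
  down_closed : ∀ a ∈ K, ∀ b ⊆ a, b ∈ K
  vertex_set : ∀ i : Fin m, ∃ a ∈ K, i ∈ a

/-- The `ℤ/2`-valued Möbius transform `M(f)(a) = ∑_{b ⊆ a} f(b)`. -/
def moebiusTransform {m : ℕ} (f : Finset (Fin m) → ZMod 2) : Finset (Fin m) → ZMod 2 :=
  fun a => ∑ b ∈ a.powerset, f b

/-- The function `δ_a` with value `1` at `a` and `0` elsewhere. -/
def deltaFun {m : ℕ} (a : Finset (Fin m)) : Finset (Fin m) → ZMod 2 :=
  fun b => if b = a then 1 else 0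

/-! ### The Stanley–Reisner face ring and its `ℕ^m`-grading -/

/-- The `0/1` vector in `ℕ^m` of a subset of `[m]`. -/
def squarefreeVec {m : ℕ} (a : Finset (Fin m)) : Fin m →₀ ℕ :=
  ∑ i ∈ a, Finsupp.single i 1

/-- The Stanley–Reisner ideal, generated by the monomials `∏_{i ∈ τ} v_i` with `τ ∉ K`. -/
def stanleyReisnerIdeal (k : Type*) [Field k] {m : ℕ} (K : Set (Finset (Fin m))) :
    Ideal (MvPolynomial (Fin m) k) :=
  Ideal.span {p | ∃ τ : Finset (Fin m), τ ∉ K ∧ p = ∏ i ∈ τ, X i}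

/-- The Stanley–Reisner face ring `k(K) = k[v] / I_K`. -/
abbrev FaceRing (k : Type*) [Field k] {m : ℕ} (K : Set (Finset (Fin m))) : Type _ :=
  MvPolynomial (Fin m) k ⧸ stanleyReisnerIdeal k K

/-- The degree `b` component of `k[v](-a)`, the free module of rank one generated in degree `a`:
it is spanned by the monomial `v^c` with `a + c = b` if there is one, and is zero otherwise. -/
def shiftedPiece (k : Type*) [Field k] {m : ℕ} (a b : Fin m →₀ ℕ) :
    Submodule k (MvPolynomial (Fin m) k) :=
  Submodule.span k {p | ∃ c : Fin m →₀ ℕ, a + c = b ∧ p = monomial c 1}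

/-- The degree `b` component of `k[v](-a₁) ⊕ ⋯ ⊕ k[v](-a_r)`. -/
def freePiece (k : Type*) [Field k] {m r : ℕ} (deg : Fin r → Fin m →₀ ℕ) (b : Fin m →₀ ℕ) :
    Set (Fin r → MvPolynomial (Fin m) k) :=
  {x | ∀ j, x j ∈ shiftedPiece k (deg j) b}

/-- The degree `b` component of the face ring: the image of the degree `b` component of `k[v]`. -/
def faceRingPiece (k : Type*) [Field k] {m : ℕ} (K : Set (Finset (Fin m))) (b : Fin m →₀ ℕ) :
    Set (FaceRing k K) :=
  Ideal.Quotient.mk (stanleyReisnerIdeal k K) '' (shiftedPiece k 0 b)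

/-! ### Minimal free resolutions and Betti numbers -/

/-- An `ℕ^m`-graded minimal free resolution of length `h`
`0 ← k(K) ← F₀ ← F₁ ← ⋯ ← F_h ← 0` of the face ring, with `F_h ≠ 0`. Here
`F_i = k[v](-deg i 0) ⊕ ⋯ ⊕ k[v](-deg i (rank i - 1))` is a free graded module of finite rank,
and `F_i = 0` for `i > h`. Minimality says that every differential becomes zero after
tensoring with `k = k[v] / ⟨v_1, …, v_m⟩`. -/
structure MinimalFreeResolution (k : Type*) [Field k] {m : ℕ} (K : Set (Finset (Fin m)))
    (h : ℕ) where
  rank : ℕ → ℕ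
  deg : ∀ i, Fin (rank i) → Fin m →₀ ℕ
  aug : (Fin (rank 0) → MvPolynomial (Fin m) k) →ₗ[MvPolynomial (Fin m) k] FaceRing k K
  d : ∀ i, (Fin (rank (i + 1)) → MvPolynomial (Fin m) k) →ₗ[MvPolynomial (Fin m) k]
    (Fin (rank i) → MvPolynomial (Fin m) k)
  aug_graded : ∀ b, ∀ x ∈ freePiece k (deg 0) b, aug x ∈ faceRingPiece k K b
  d_graded : ∀ i b, ∀ x ∈ freePiece k (deg (i + 1)) b, d i x ∈ freePiece k (deg i) b
  aug_surjective : Function.Surjective aug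
  exact_aug : Function.Exact (d 0) aug
  exact_d : ∀ i, Function.Exact (d (i + 1)) (d i)
  minimal : ∀ i x j, d i x j ∈ Ideal.span (Set.range (X : Fin m → MvPolynomial (Fin m) k))
  rank_length : rank h ≠ 0
  rank_of_length_lt : ∀ i, h < i → rank i = 0

/-- The number of summands `k[v](-a)` in `F_i`, for `a` in `ℕ^m`. -/
def MinimalFreeResolution.multigradedBetti {k : Type*} [Field k] {m : ℕ}
    {K : Set (Finset (Fin m))} {h : ℕ} (F : MinimalFreeResolution k K h) (i : ℕ)
    (a : Fin m →₀ ℕ) : ℕ :=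
  Fintype.card {j : Fin (F.rank i) // F.deg i j = a}

/-- The Betti number `β_{i,a}` for a subset `a` of `[m]`. -/
def MinimalFreeResolution.betti {k : Type*} [Field k] {m : ℕ}
    {K : Set (Finset (Fin m))} {h : ℕ} (F : MinimalFreeResolution k K h) (i : ℕ)
    (a : Finset (Fin m)) : ℕ :=
  F.multigradedBetti i (squarefreeVec a)

end

/-! In each degree `b`, a graded map between free modules over `k[v]` is given by its matrix with
all `v_i` set to `1`, acting on the vectors supported on the generators of degree at most `b`. So
the degree `b` strand of a resolution is an exact sequence of vector spaces whose `i`-th term has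
dimension `#{j | deg i j ≤ b}`, and for squarefree `b = a` its Euler characteristic reads
`∑ i, (-1)^i ∑ c ⊆ a, β_{i,c} = [a ∈ K]`. Modulo 2 this says that `f` is the Möbius transform of
`a ↦ ∑ i, β_{i,a}`, and the Möbius transform over `ℤ/2` is an involution.

A resolution exists because the relations in degree `b` of the face ring, and then of each of its
syzygy modules, depend only on the support of `b`. Hence all of them can be minimally generated in
squarefree degrees, and since these degrees increase strictly along a minimal presentation, the
construction stops after at most `m` steps. -/

section LinearAlgebra

theorem finrank_map_add_finrank_ker_inf {k V W : Type*} [DivisionRing k] [AddCommGroup V]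
    [Module k V] [AddCommGroup W] [Module k W] (f : V →ₗ[k] W) (U : Submodule k V)
    [FiniteDimensional k U] :
    Module.finrank k (U.map f) + Module.finrank k ↥(LinearMap.ker f ⊓ U) = Module.finrank k U := by
  rw [← (f.domRestrict U).finrank_range_add_finrank_ker, LinearMap.range_domRestrict,
    LinearMap.ker_domRestrict, inf_comm, ← Submodule.map_comap_subtype,
    Submodule.finrank_map_subtype_eq]

theorem sum_neg_one_pow_mul_of_telescoping {R : Type*} [CommRing R] {c ρ : ℕ → R} {e : R}
    (hzero : c 0 = e + ρ 0) (hsucc : ∀ i, c (i + 1) = ρ i + ρ (i + 1)) (n : ℕ) :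
    ∑ i ∈ Finset.range (n + 1), (-1) ^ i * c i = e + (-1) ^ n * ρ n := by
  induction n with
  | zero => simp [hzero]
  | succ n ih => rw [Finset.sum_range_succ, ih, hsucc]; ring

section CoeffsBelow

variable {ι P : Type*} [Preorder P]

/-- The vectors supported on the generators `j` of degree `s j ≤ a`. For a free graded module over
`k[v]` these are the coordinates of its degree `a` component. -/
def coeffsBelow (R : Type*) [Semiring R] (s : ι → P) (a : P) : Submodule R (ι → R) :=
  ⨅ j ∈ {j | ¬ s j ≤ a}, LinearMap.ker (LinearMap.proj j)

variable {R : Type*} [Semiring R] {s : ι → P} {a : P}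

theorem mem_coeffsBelow {c : ι → R} : c ∈ coeffsBelow R s a ↔ ∀ j, ¬ s j ≤ a → c j = 0 := by
  simp [coeffsBelow]

theorem le_of_mem_coeffsBelow {c : ι → R} (hc : c ∈ coeffsBelow R s a) {j : ι} (hj : c j ≠ 0) :
    s j ≤ a :=
  not_not.1 fun h => hj (mem_coeffsBelow.1 hc j h)

theorem coeffsBelow_mono : Monotone (coeffsBelow R s) :=
  fun _ _ hab _ hc => mem_coeffsBelow.2 fun j hj => mem_coeffsBelow.1 hc j fun h => hj (h.trans hab)

theorem single_mem_coeffsBelow [DecidableEq ι] {j : ι} (hj : s j ≤ a) (r : R) :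
    Pi.single j r ∈ coeffsBelow R s a := by
  refine mem_coeffsBelow.2 fun i hi => ?_
  have hij : i ≠ j := by rintro rfl; exact hi hj
  rw [Pi.single_eq_of_ne hij]

theorem finrank_coeffsBelow [StrongRankCondition R] [Fintype ι] [DecidablePred (s · ≤ a)] :
    Module.finrank R (coeffsBelow R s a) = Fintype.card {j // s j ≤ a} := by
  have e := LinearMap.iInfKerProjEquiv R (fun _ : ι => R) (I := {j | s j ≤ a})
    (J := {j | ¬ s j ≤ a}) disjoint_compl_right (Set.union_compl_self _).ge
  rw [coeffsBelow, e.finrank_eq, Module.finrank_fintype_fun_eq_card]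
  exact Fintype.card_congr (Equiv.refl _)

end CoeffsBelow

theorem apply_mem_map_linearCombination {k V ι P : Type*} [Semiring k] [AddCommMonoid V]
    [Module k V] [Fintype ι] [Preorder P] {s : ι → P} (g : ι → V) {a : P} {j : ι} (hj : s j ≤ a) :
    g j ∈ (coeffsBelow k s a).map (Fintype.linearCombination k g) := by
  classical
  exact ⟨Pi.single j 1, single_mem_coeffsBelow hj 1, by
    rw [Fintype.linearCombination_apply_single, one_smul]⟩

theorem linearCombination_mem_of_mem_coeffsBelow {k V ι P : Type*} [Semiring k] [AddCommMonoid V]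
    [Module k V] [Fintype ι] [Preorder P] {W : P → Submodule k V} (hW : Monotone W) {s : ι → P}
    {g : ι → V} (hg : ∀ j, g j ∈ W (s j)) {a : P} {c : ι → k} (hc : c ∈ coeffsBelow k s a) :
    Fintype.linearCombination k g c ∈ W a := by
  rw [Fintype.linearCombination_apply]
  refine Submodule.sum_mem _ fun j _ => ?_
  by_cases hj : c j = 0
  · simp only [hj, zero_smul, zero_mem]
  · exact Submodule.smul_mem _ _ (hW (le_of_mem_coeffsBelow hc hj) (hg j))

section MinimalGenerators

variable {k V ι P : Type*} [Field k] [AddCommGroup V] [Module k V] [PartialOrder P]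

/-- The vectors `g j`, placed in degrees `s j`, minimally generate the family of subspaces `W`: each
`W a` is spanned by the generators of degree at most `a`, and minimality is expressed by the fact
that a relation living in degree `s j` does not involve the generator `j`. -/
structure IsMinimalGenerators [Fintype ι] (W : P → Submodule k V) (s : ι → P) (g : ι → V) :
    Prop where
  map_eq : ∀ a, (coeffsBelow k s a).map (Fintype.linearCombination k g) = W a
  coeff_eq_zero : ∀ c ∈ LinearMap.ker (Fintype.linearCombination k g), ∀ j,
    c ∈ coeffsBelow k s (s j) → c j = 0

theorem IsMinimalGenerators.mem [Fintype ι] {W : P → Submodule k V} {s : ι → P} {g : ι → V}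
    (h : IsMinimalGenerators W s g) (j : ι) : g j ∈ W (s j) :=
  h.map_eq (s j) ▸ apply_mem_map_linearCombination g le_rfl

theorem IsMinimalGenerators.comp_equiv {κ : Type*} [Fintype ι] [Fintype κ]
    {W : P → Submodule k V} {s : ι → P} {g : ι → V} (h : IsMinimalGenerators W s g) (e : κ ≃ ι) :
    IsMinimalGenerators W (s ∘ e) (g ∘ e) := by
  have hlc : ∀ c : ι → k, Fintype.linearCombination k (g ∘ e) (c ∘ e) =
      Fintype.linearCombination k g c := fun c => e.sum_comp fun i => c i • g i
  have hbelow : ∀ {c : ι → k} {a : P},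
      c ∘ e ∈ coeffsBelow k (s ∘ e) a ↔ c ∈ coeffsBelow k s a := fun {c a} => by
    rw [mem_coeffsBelow, mem_coeffsBelow, ← e.forall_congr_right]
    rfl
  refine ⟨fun a => ?_, fun c hc j hcj => ?_⟩
  · rw [← h.map_eq]
    ext w
    simp only [Submodule.mem_map, ← (e.arrowCongr (Equiv.refl k)).symm.exists_congr_right]
    exact exists_congr fun c => and_congr hbelow (by rw [← hlc c]; rfl)
  · obtain ⟨c, rfl⟩ := (e.arrowCongr (Equiv.refl k)).symm.surjective c
    exact h.coeff_eq_zero c ((hlc c).symm.trans hc) (e j) (hbelow.1 hcj)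

variable {W C : P → Submodule k V}

theorem le_iSup_le_of_iSup_lt_sup_eq [WellFoundedLT P]
    (hsup : ∀ a, (⨆ b < a, W b) ⊔ C a = W a) (a : P) : W a ≤ ⨆ b ≤ a, C b := by
  induction a using WellFoundedLT.induction with
  | ind a ih =>
    rw [← hsup a]
    refine sup_le (iSup₂_le fun b hb => (ih b hb).trans ?_) (le_iSup₂_of_le a le_rfl le_rfl)
    exact biSup_mono fun c hc => hc.trans hb.le

theorem eq_zero_of_sum_eq_zero_of_disjoint_iSup_lt [Fintype P] (hCW : C ≤ W) {a : P}
    (hdisj : Disjoint (⨆ b < a, W b) (C a)) {v : P → V} (hv : ∀ b, v b ∈ C b)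
    (hle : ∀ b, v b ≠ 0 → b ≤ a) (hsum : ∑ b, v b = 0) : v a = 0 := by
  classical
  refine Submodule.disjoint_def.1 hdisj _ ?_ (hv a)
  rw [← Finset.add_sum_erase _ _ (Finset.mem_univ a)] at hsum
  rw [eq_neg_of_add_eq_zero_left hsum]
  refine neg_mem (Submodule.sum_mem _ fun b hb => ?_)
  by_cases hb0 : v b = 0
  · simp only [hb0, zero_mem]
  · have hlt : b < a := lt_of_le_of_ne (hle b hb0) (Finset.ne_of_mem_erase hb)
    exact le_iSup₂ (f := fun b (_ : b < a) => W b) b hlt (hCW b (hv b))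

theorem isMinimalGenerators_sigma_basis [Fintype P] {κ : P → Type*} [∀ a, Fintype (κ a)]
    (hW : Monotone W) (hdisj : ∀ a, Disjoint (⨆ b < a, W b) (C a))
    (hsup : ∀ a, (⨆ b < a, W b) ⊔ C a = W a) (B : ∀ a, Module.Basis (κ a) k (C a)) :
    IsMinimalGenerators W Sigma.fst (fun i : Σ a, κ a => (B i.1 i.2 : V)) := by
  classical
  have hCW : C ≤ W := fun a => hsup a ▸ le_sup_right
  let g : (Σ a, κ a) → V := fun i => B i.1 i.2
  refine ⟨fun a => le_antisymm ?_ ?_, ?_⟩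
  · rintro _ ⟨c, hc, rfl⟩
    exact linearCombination_mem_of_mem_coeffsBelow (g := g) hW (fun j => hCW _ (B j.1 j.2).2) hc
  · refine (le_iSup_le_of_iSup_lt_sup_eq hsup a).trans (iSup₂_le fun b hb => ?_)
    rintro w hw
    lift w to C b using hw
    rw [← (B b).sum_repr w, Submodule.coe_sum]
    refine Submodule.sum_mem _ fun i _ => Submodule.smul_mem _ _ ?_
    exact apply_mem_map_linearCombination (s := Sigma.fst) (j := ⟨b, i⟩) g hb
  · rintro c hc ⟨a, i⟩ hca
    let v : ∀ b, C b := fun b => ∑ i, c ⟨b, i⟩ • B b i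
    have hsum : ∑ b, (v b : V) = 0 := by
      rw [LinearMap.mem_ker, Fintype.linearCombination_apply, Fintype.sum_sigma] at hc
      simpa only [v, Submodule.coe_sum, Submodule.coe_smul] using hc
    have hle : ∀ b, (v b : V) ≠ 0 → b ≤ a := by
      intro b hb
      by_contra hba
      refine hb ?_
      simp only [v, fun i => mem_coeffsBelow.1 hca ⟨b, i⟩ hba, zero_smul, Finset.sum_const_zero,
        Submodule.coe_zero]
    have hva : v a = 0 := Subtype.ext
      (eq_zero_of_sum_eq_zero_of_disjoint_iSup_lt hCW (hdisj a) (fun b => (v b).2) hle hsum)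
    exact Fintype.linearIndependent_iff.1 (B a).linearIndependent _ hva i

theorem exists_isMinimalGenerators [Finite P] [FiniteDimensional k V] (hW : Monotone W) :
    ∃ (n : ℕ) (s : Fin n → P) (g : Fin n → V), IsMinimalGenerators W s g := by
  have := Fintype.ofFinite P
  have hlt_le (a : P) : ⨆ b < a, W b ≤ W a := iSup₂_le fun b hb => hW hb.le
  choose C hdisj hsup using fun a => IsModularLattice.exists_disjoint_and_sup_eq (hlt_le a)
  have h := isMinimalGenerators_sigma_basis hW hdisj hsup fun a => Module.finBasis k (C a)
  exact ⟨_, _, _, h.comp_equiv (Fintype.equivFin _).symm⟩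

end MinimalGenerators

end LinearAlgebra

section GradedFreeModules

section ComponentCoeffs

variable {σ ι R : Type*} [CommSemiring R]

open Classical in
/-- Coordinates of the degree `b` component of `x` in the free graded module with generators in
degrees `deg l`: the coefficient at `l` is that of `v^(b - deg l)` in `x l`, and is `0` when
`deg l ≤ b` fails, where the truncated subtraction is meaningless. -/
noncomputable def componentCoeffs (deg : ι → σ →₀ ℕ) (b : σ →₀ ℕ) :
    (ι → MvPolynomial σ R) →ₗ[R] (ι → R) :=
  LinearMap.pi fun l => if deg l ≤ b then lcoeff R (b - deg l) ∘ₗ LinearMap.proj l else 0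

open Classical in
/-- The element of degree `b` with coordinates `w`; it ignores `w l` unless `deg l ≤ b`. -/
noncomputable def ofComponentCoeffs (deg : ι → σ →₀ ℕ) (b : σ →₀ ℕ) (w : ι → R) :
    ι → MvPolynomial σ R :=
  fun l => if deg l ≤ b then monomial (b - deg l) (w l) else 0

variable {deg : ι → σ →₀ ℕ} {b : σ →₀ ℕ}

theorem componentCoeffs_apply_of_le (x : ι → MvPolynomial σ R) {l : ι} (h : deg l ≤ b) :
    componentCoeffs deg b x l = coeff (b - deg l) (x l) := by
  simp [componentCoeffs, h]

theorem componentCoeffs_apply_of_not_le (x : ι → MvPolynomial σ R) {l : ι} (h : ¬ deg l ≤ b) :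
    componentCoeffs deg b x l = 0 := by
  simp [componentCoeffs, h]

theorem componentCoeffs_mem_coeffsBelow (deg : ι → σ →₀ ℕ) (b : σ →₀ ℕ)
    (x : ι → MvPolynomial σ R) : componentCoeffs deg b x ∈ coeffsBelow R deg b :=
  mem_coeffsBelow.2 fun _ => componentCoeffs_apply_of_not_le x

theorem componentCoeffs_add_deg (deg : ι → σ →₀ ℕ) (c : σ →₀ ℕ) (x : ι → MvPolynomial σ R)
    (l : ι) : componentCoeffs deg (c + deg l) x l = coeff c (x l) := by
  rw [componentCoeffs_apply_of_le x le_add_self, add_tsub_cancel_right]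

theorem ext_componentCoeffs (deg : ι → σ →₀ ℕ) {x y : ι → MvPolynomial σ R}
    (h : ∀ b, componentCoeffs deg b x = componentCoeffs deg b y) : x = y := by
  funext l
  ext c
  rw [← componentCoeffs_add_deg deg c x l, ← componentCoeffs_add_deg deg c y l, h]

theorem componentCoeffs_ofComponentCoeffs {w : ι → R} (hw : w ∈ coeffsBelow R deg b) :
    componentCoeffs deg b (ofComponentCoeffs deg b w) = w := by
  classical
  funext l
  by_cases h : deg l ≤ b
  · rw [componentCoeffs_apply_of_le _ h, ofComponentCoeffs, if_pos h, coeff_monomial, if_pos rfl]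
  · rw [componentCoeffs_apply_of_not_le _ h, mem_coeffsBelow.1 hw l h]

theorem componentCoeffs_ofComponentCoeffs_of_ne {b' : σ →₀ ℕ} (hb : b' ≠ b) (w : ι → R) :
    componentCoeffs deg b' (ofComponentCoeffs deg b w) = 0 := by
  classical
  funext l
  by_cases h' : deg l ≤ b'
  · by_cases h : deg l ≤ b
    · have hsub : b - deg l ≠ b' - deg l := fun e => hb ((tsub_left_inj h h').1 e).symm
      simp [componentCoeffs_apply_of_le _ h', ofComponentCoeffs, h, coeff_monomial, hsub]
    · simp [componentCoeffs_apply_of_le _ h', ofComponentCoeffs, h]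
  · exact componentCoeffs_apply_of_not_le _ h'

theorem finite_setOf_componentCoeffs_ne_zero [Finite ι] (deg : ι → σ →₀ ℕ)
    (x : ι → MvPolynomial σ R) : {b | componentCoeffs deg b x ≠ 0}.Finite := by
  refine (Set.finite_iUnion fun l => (x l).support.finite_toSet.image (· + deg l)).subset ?_
  intro b hb
  obtain ⟨l, hl⟩ := Function.ne_iff.1 hb
  have hle : deg l ≤ b := le_of_mem_coeffsBelow (componentCoeffs_mem_coeffsBelow deg b x) hl
  rw [componentCoeffs_apply_of_le x hle] at hl
  exact Set.mem_iUnion.2 ⟨l, b - deg l, mem_support_iff.2 hl, tsub_add_cancel_of_le hle⟩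

theorem exists_eq_sum_ofComponentCoeffs [Finite ι] (deg : ι → σ →₀ ℕ) (x : ι → MvPolynomial σ R) :
    ∃ B : Finset (σ →₀ ℕ), x = ∑ b ∈ B, ofComponentCoeffs deg b (componentCoeffs deg b x) := by
  refine ⟨(finite_setOf_componentCoeffs_ne_zero deg x).toFinset,
    ext_componentCoeffs deg fun b => ?_⟩
  have hself := componentCoeffs_ofComponentCoeffs (componentCoeffs_mem_coeffsBelow deg b x)
  rw [map_sum, Finset.sum_eq_single b, hself]
  · exact fun b' _ hne => componentCoeffs_ofComponentCoeffs_of_ne hne.symm _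
  · intro hb
    rw [hself]
    simpa using hb

theorem inf_coeffsBelow_eq_of_forall_componentCoeffs_mem_iff
    {W W' : (σ →₀ ℕ) → Submodule R (ι → R)}
    (h : ∀ x : ι → MvPolynomial σ R,
      (∀ b, componentCoeffs deg b x ∈ W b) ↔ ∀ b, componentCoeffs deg b x ∈ W' b)
    (b : σ →₀ ℕ) : W b ⊓ coeffsBelow R deg b = W' b ⊓ coeffsBelow R deg b := by
  have key (W : (σ →₀ ℕ) → Submodule R (ι → R)) {w : ι → R} (hw : w ∈ coeffsBelow R deg b) :
      (∀ b', componentCoeffs deg b' (ofComponentCoeffs deg b w) ∈ W b') ↔ w ∈ W b := by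
    refine ⟨fun h => componentCoeffs_ofComponentCoeffs hw ▸ h b, fun h b' => ?_⟩
    rcases eq_or_ne b' b with rfl | hne
    · rwa [componentCoeffs_ofComponentCoeffs hw]
    · rw [componentCoeffs_ofComponentCoeffs_of_ne hne]
      exact zero_mem _
  ext w
  exact and_congr_left fun hw => (key W hw).symm.trans ((h _).trans (key W' hw))

end ComponentCoeffs

variable {k : Type*} [Field k] {m q r : ℕ}

theorem mem_shiftedPiece_iff {a b : Fin m →₀ ℕ} {f : MvPolynomial (Fin m) k} :
    f ∈ shiftedPiece k a b ↔ ∀ c ∈ f.support, a + c = b := by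
  have himage : {f : MvPolynomial (Fin m) k | ∃ c, a + c = b ∧ f = monomial c 1} =
      (fun c => monomial c 1) '' {c | a + c = b} := by
    ext f
    exact exists_congr fun c => and_congr_right' eq_comm
  rw [shiftedPiece, himage, ← restrictSupport_eq_span]
  rfl

theorem mem_freePiece_iff {deg : Fin r → Fin m →₀ ℕ} {b : Fin m →₀ ℕ}
    {x : Fin r → MvPolynomial (Fin m) k} :
    x ∈ freePiece k deg b ↔ ∀ b' ≠ b, componentCoeffs deg b' x = 0 := by
  refine ⟨fun hx b' hb => funext fun l => ?_, fun hx l => mem_shiftedPiece_iff.2 fun c hc => ?_⟩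
  · by_contra hl
    have hle : deg l ≤ b' := le_of_mem_coeffsBelow (componentCoeffs_mem_coeffsBelow deg b' x) hl
    rw [componentCoeffs_apply_of_le x hle] at hl
    exact hb (by rw [← mem_shiftedPiece_iff.1 (hx l) _ (mem_support_iff.2 hl),
      add_tsub_cancel_of_le hle])
  · by_contra hne
    rw [mem_support_iff, ← componentCoeffs_add_deg deg c x l, hx _ (add_comm c _ ▸ hne)] at hc
    exact hc rfl

theorem ofComponentCoeffs_mem_freePiece (deg : Fin r → Fin m →₀ ℕ) (b : Fin m →₀ ℕ)
    (w : Fin r → k) : ofComponentCoeffs deg b w ∈ freePiece k deg b :=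
  mem_freePiece_iff.2 fun _ hb => componentCoeffs_ofComponentCoeffs_of_ne hb w

theorem ofComponentCoeffs_componentCoeffs {deg : Fin r → Fin m →₀ ℕ} {b : Fin m →₀ ℕ}
    {x : Fin r → MvPolynomial (Fin m) k} (hx : x ∈ freePiece k deg b) :
    ofComponentCoeffs deg b (componentCoeffs deg b x) = x := by
  refine ext_componentCoeffs deg fun b' => ?_
  rcases eq_or_ne b' b with rfl | hne
  · exact componentCoeffs_ofComponentCoeffs (componentCoeffs_mem_coeffsBelow deg b' x)
  · rw [componentCoeffs_ofComponentCoeffs_of_ne hne, mem_freePiece_iff.1 hx b' hne]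

theorem single_mem_freePiece (deg : Fin r → Fin m →₀ ℕ) (j : Fin r) :
    (Pi.single j 1 : Fin r → MvPolynomial (Fin m) k) ∈ freePiece k deg (deg j) := by
  classical
  refine fun l => mem_shiftedPiece_iff.2 fun c hc => ?_
  obtain rfl : l = j := by
    by_contra hne
    simp [Pi.single_eq_of_ne hne] at hc
  simpa [coeff_one, eq_comm] using hc

open Classical in
theorem componentCoeffs_smul_of_mem_freePiece {deg : Fin r → Fin m →₀ ℕ} {a : Fin m →₀ ℕ}
    {u : Fin r → MvPolynomial (Fin m) k} (hu : u ∈ freePiece k deg a) (b : Fin m →₀ ℕ)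
    (f : MvPolynomial (Fin m) k) :
    componentCoeffs deg b (f • u) =
      (if a ≤ b then coeff (b - a) f else 0) • componentCoeffs deg a u := by
  obtain ⟨w, rfl⟩ : ∃ w, ofComponentCoeffs deg a w = u := ⟨_, ofComponentCoeffs_componentCoeffs hu⟩
  funext l
  by_cases hla : deg l ≤ a
  · by_cases hlb : deg l ≤ b
    · simp only [componentCoeffs_apply_of_le _ hla, componentCoeffs_apply_of_le _ hlb,
        ofComponentCoeffs, Pi.smul_apply, smul_eq_mul, if_pos hla, coeff_monomial, if_true,
        coeff_mul_monomial', tsub_le_tsub_iff_right hlb, tsub_tsub_tsub_cancel_right hla, ite_mul,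
        zero_mul]
    · have hab : ¬ a ≤ b := fun hab => hlb (hla.trans hab)
      rw [componentCoeffs_apply_of_not_le _ hlb, if_neg hab, zero_smul, Pi.zero_apply]
  · have hzero : (f • ofComponentCoeffs deg a w) l = 0 := by
      rw [Pi.smul_apply, ofComponentCoeffs, if_neg hla, smul_zero]
    rw [Pi.smul_apply, componentCoeffs_apply_of_not_le _ hla, smul_zero]
    by_cases hlb : deg l ≤ b
    · rw [componentCoeffs_apply_of_le _ hlb, hzero, coeff_zero]
    · exact componentCoeffs_apply_of_not_le _ hlb

/-- The map `φ` between free graded modules, with generators in degrees `deg'` and `deg`, preserves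
degrees. -/
def IsGradedMap (deg' : Fin q → Fin m →₀ ℕ) (deg : Fin r → Fin m →₀ ℕ)
    (φ : (Fin q → MvPolynomial (Fin m) k) →ₗ[MvPolynomial (Fin m) k]
      (Fin r → MvPolynomial (Fin m) k)) : Prop :=
  ∀ b, ∀ x ∈ freePiece k deg' b, φ x ∈ freePiece k deg b

/-- The matrix of a graded map `φ` with its monomials dropped (each `v_i` set to `1`). By
`IsGradedMap.componentCoeffs_map`, this one matrix describes `φ` in every degree. -/
noncomputable def scalarMap (deg' : Fin q → Fin m →₀ ℕ) (deg : Fin r → Fin m →₀ ℕ)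
    (φ : (Fin q → MvPolynomial (Fin m) k) →ₗ[MvPolynomial (Fin m) k]
      (Fin r → MvPolynomial (Fin m) k)) : (Fin q → k) →ₗ[k] (Fin r → k) :=
  Fintype.linearCombination k fun j => componentCoeffs deg (deg' j) (φ (Pi.single j 1))

section

variable {deg' : Fin q → Fin m →₀ ℕ} {deg : Fin r → Fin m →₀ ℕ}
  {φ : (Fin q → MvPolynomial (Fin m) k) →ₗ[MvPolynomial (Fin m) k]
    (Fin r → MvPolynomial (Fin m) k)}

theorem componentCoeffs_map_of_single_mem
    (hφ : ∀ j, φ (Pi.single j 1) ∈ freePiece k deg (deg' j)) (b : Fin m →₀ ℕ)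
    (x : Fin q → MvPolynomial (Fin m) k) :
    componentCoeffs deg b (φ x) = scalarMap deg' deg φ (componentCoeffs deg' b x) := by
  classical
  conv_lhs => rw [pi_eq_sum_univ' x, map_sum, map_sum]
  rw [scalarMap, Fintype.linearCombination_apply]
  refine Finset.sum_congr rfl fun j _ => ?_
  rw [map_smul, componentCoeffs_smul_of_mem_freePiece (hφ j)]
  by_cases h : deg' j ≤ b
  · rw [if_pos h, componentCoeffs_apply_of_le x h]
  · rw [if_neg h, componentCoeffs_apply_of_not_le x h]

theorem IsGradedMap.componentCoeffs_map (hφ : IsGradedMap deg' deg φ) (b : Fin m →₀ ℕ)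
    (x : Fin q → MvPolynomial (Fin m) k) :
    componentCoeffs deg b (φ x) = scalarMap deg' deg φ (componentCoeffs deg' b x) :=
  componentCoeffs_map_of_single_mem (fun j => hφ _ _ (single_mem_freePiece deg' j)) b x

theorem isGradedMap_of_single_mem (hφ : ∀ j, φ (Pi.single j 1) ∈ freePiece k deg (deg' j)) :
    IsGradedMap deg' deg φ := by
  refine fun b x hx => mem_freePiece_iff.2 fun b' hb => ?_
  rw [componentCoeffs_map_of_single_mem hφ, mem_freePiece_iff.1 hx b' hb, map_zero]

theorem IsGradedMap.map_ofComponentCoeffs (hφ : IsGradedMap deg' deg φ) {b : Fin m →₀ ℕ}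
    {w : Fin q → k} (hw : w ∈ coeffsBelow k deg' b) :
    φ (ofComponentCoeffs deg' b w) = ofComponentCoeffs deg b (scalarMap deg' deg φ w) := by
  have hmem := hφ b _ (ofComponentCoeffs_mem_freePiece deg' b w)
  rw [← ofComponentCoeffs_componentCoeffs hmem, hφ.componentCoeffs_map,
    componentCoeffs_ofComponentCoeffs hw]

theorem IsGradedMap.eq_zero_iff (hφ : IsGradedMap deg' deg φ)
    (x : Fin q → MvPolynomial (Fin m) k) :
    φ x = 0 ↔ ∀ b, componentCoeffs deg' b x ∈ LinearMap.ker (scalarMap deg' deg φ) := by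
  simp only [LinearMap.mem_ker, ← hφ.componentCoeffs_map]
  refine ⟨fun h b => by rw [h, map_zero], fun h => ext_componentCoeffs deg fun b => ?_⟩
  rw [h, map_zero]

theorem IsGradedMap.mem_range_iff (hφ : IsGradedMap deg' deg φ)
    (y : Fin r → MvPolynomial (Fin m) k) :
    y ∈ Set.range φ ↔
      ∀ b, componentCoeffs deg b y ∈ (coeffsBelow k deg' b).map (scalarMap deg' deg φ) := by
  constructor
  · rintro ⟨x, rfl⟩ b
    exact ⟨_, componentCoeffs_mem_coeffsBelow deg' b x, (hφ.componentCoeffs_map b x).symm⟩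
  · intro h
    obtain ⟨B, hB⟩ := exists_eq_sum_ofComponentCoeffs deg y
    rw [hB, ← LinearMap.coe_range]
    refine Submodule.sum_mem _ fun b _ => ?_
    obtain ⟨w, hw, hwy⟩ := h b
    exact ⟨ofComponentCoeffs deg' b w, by rw [hφ.map_ofComponentCoeffs hw, hwy]⟩

theorem IsGradedMap.scalarMap_mem_coeffsBelow (hφ : IsGradedMap deg' deg φ) {b : Fin m →₀ ℕ}
    {w : Fin q → k} (hw : w ∈ coeffsBelow k deg' b) :
    scalarMap deg' deg φ w ∈ coeffsBelow k deg b := by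
  rw [← componentCoeffs_ofComponentCoeffs hw, ← hφ.componentCoeffs_map]
  exact componentCoeffs_mem_coeffsBelow deg b _

theorem IsGradedMap.inf_coeffsBelow_eq_map_of_exact (hφ : IsGradedMap deg' deg φ) {M : Type*}
    [Zero M] {ψ : (Fin r → MvPolynomial (Fin m) k) → M} (hexact : Function.Exact φ ψ)
    {W : (Fin m →₀ ℕ) → Submodule k (Fin r → k)}
    (hψ : ∀ x, ψ x = 0 ↔ ∀ b, componentCoeffs deg b x ∈ W b) (b : Fin m →₀ ℕ) :
    W b ⊓ coeffsBelow k deg b = (coeffsBelow k deg' b).map (scalarMap deg' deg φ) := by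
  have hle : (coeffsBelow k deg' b).map (scalarMap deg' deg φ) ≤ coeffsBelow k deg b :=
    Submodule.map_le_iff_le_comap.2 fun _ => hφ.scalarMap_mem_coeffsBelow
  rw [← inf_eq_left.2 hle]
  refine inf_coeffsBelow_eq_of_forall_componentCoeffs_mem_iff
    (W' := fun b => (coeffsBelow k deg' b).map (scalarMap deg' deg φ)) (fun x => ?_) b
  rw [← hψ, hexact x, hφ.mem_range_iff]

end

end GradedFreeModules

section StanleyReisner

variable {m : ℕ}

theorem squarefreeVec_apply (a : Finset (Fin m)) (i : Fin m) :
    squarefreeVec a i = if i ∈ a then 1 else 0 := by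
  simp [squarefreeVec, Finsupp.single_apply]

theorem squarefreeVec_le_iff {a : Finset (Fin m)} {b : Fin m →₀ ℕ} :
    squarefreeVec a ≤ b ↔ a ⊆ b.support := by
  refine forall_congr' fun i => ?_
  rw [squarefreeVec_apply, Finsupp.mem_support_iff]
  by_cases h : i ∈ a <;> simp [h, Nat.one_le_iff_ne_zero]

theorem support_squarefreeVec (a : Finset (Fin m)) : (squarefreeVec a).support = a := by
  ext i
  simp [squarefreeVec_apply]

theorem squarefreeVec_injective :
    Function.Injective (squarefreeVec : Finset (Fin m) → Fin m →₀ ℕ) :=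
  Function.LeftInverse.injective support_squarefreeVec

theorem le_squarefreeVec_iff {a : Finset (Fin m)} {b : Fin m →₀ ℕ} :
    b ≤ squarefreeVec a ↔ ∃ c ⊆ a, b = squarefreeVec c := by
  refine ⟨fun h => ⟨b.support, ?_, ?_⟩, ?_⟩
  · exact support_squarefreeVec a ▸ Finsupp.support_mono h
  · refine le_antisymm (fun i => ?_) (squarefreeVec_le_iff.2 subset_rfl)
    have hi := h i
    simp only [squarefreeVec_apply, Finsupp.mem_support_iff] at hi ⊢
    split_ifs at hi ⊢ <;> omega
  · rintro ⟨c, hc, rfl⟩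
    rwa [squarefreeVec_le_iff, support_squarefreeVec]

variable {k : Type*} [Field k] {K : Set (Finset (Fin m))}

theorem stanleyReisnerIdeal_eq_span_monomial (k : Type*) [Field k] (K : Set (Finset (Fin m))) :
    stanleyReisnerIdeal k K =
      Ideal.span ((fun b => monomial b (1 : k)) '' (squarefreeVec '' Kᶜ)) := by
  rw [stanleyReisnerIdeal, Set.image_image]
  congr 1
  ext p
  refine exists_congr fun τ => and_congr_right fun _ => ?_
  rw [eq_comm]
  exact Eq.congr_left (monomial_sum_one τ _).symm

theorem mem_stanleyReisnerIdeal_iff (hK : IsLowerSet K) {p : MvPolynomial (Fin m) k} :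
    p ∈ stanleyReisnerIdeal k K ↔ ∀ b, b.support ∈ K → coeff b p = 0 := by
  rw [stanleyReisnerIdeal_eq_span_monomial, mem_ideal_span_monomial_image]
  refine ⟨fun h b hb => ?_, fun h b hb => ?_⟩
  · by_contra hc
    obtain ⟨_, ⟨τ, hτ, rfl⟩, hle⟩ := h b (mem_support_iff.2 hc)
    exact hτ (hK (squarefreeVec_le_iff.1 hle) hb)
  · refine ⟨squarefreeVec b.support, ⟨_, fun hbK => ?_, rfl⟩, squarefreeVec_le_iff.2 subset_rfl⟩
    exact mem_support_iff.1 hb (h b hbK)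

theorem exists_eq_mk_monomial_of_mem_faceRingPiece {b : Fin m →₀ ℕ} {y : FaceRing k K}
    (hy : y ∈ faceRingPiece k K b) : ∃ t : k, y = Ideal.Quotient.mk _ (monomial b t) := by
  obtain ⟨p, hp, rfl⟩ := hy
  refine ⟨coeff b p, congrArg _ (MvPolynomial.ext _ _ fun c => ?_)⟩
  rw [coeff_monomial]
  split_ifs with hbc
  · rw [hbc]
  · refine notMem_support_iff.1 fun hc => hbc ?_
    rw [← mem_shiftedPiece_iff.1 hp c hc, zero_add]

end StanleyReisner

section EulerCharacteristic

variable {k : Type*} [Field k] {m : ℕ}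

namespace MinimalFreeResolution

variable {K : Set (Finset (Fin m))} {h : ℕ} (F : MinimalFreeResolution k K h)

theorem isGradedMap_d (i : ℕ) : IsGradedMap (F.deg (i + 1)) (F.deg i) (F.d i) :=
  F.d_graded i

/-- The rank of the degree `b` component of the differential `F_{i+1} → F_i`. -/
noncomputable def differentialRank (b : Fin m →₀ ℕ) (i : ℕ) : ℕ :=
  Module.finrank k
    ((coeffsBelow k (F.deg (i + 1)) b).map (scalarMap (F.deg (i + 1)) (F.deg i) (F.d i)))

theorem differentialRank_length (b : Fin m →₀ ℕ) : F.differentialRank b h = 0 := by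
  have hrank : F.rank (h + 1) = 0 := F.rank_of_length_lt _ (Nat.lt_succ_self h)
  refine Nat.le_zero.1 ((Submodule.finrank_map_le _ _).trans ((Submodule.finrank_le _).trans ?_))
  rw [Module.finrank_fin_fun, hrank]

theorem exists_linearMap_aug_eq_mk_iff (hK : IsLowerSet K) :
    ∃ ε : (Fin (F.rank 0) → k) →ₗ[k] k, ∀ p x, F.aug x = Ideal.Quotient.mk _ p ↔
      ∀ b, b.support ∈ K → ε (componentCoeffs (F.deg 0) b x) = coeff b p := by
  choose t ht using fun j => exists_eq_mk_monomial_of_mem_faceRingPiece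
    (F.aug_graded _ _ (single_mem_freePiece (F.deg 0) j))
  have haug : ∀ x, F.aug x = Ideal.Quotient.mk _ (∑ j, x j * monomial (F.deg 0 j) (t j)) := by
    intro x
    conv_lhs => rw [pi_eq_sum_univ' x, map_sum]
    rw [map_sum]
    refine Finset.sum_congr rfl fun j _ => ?_
    rw [map_smul, ht]
    rfl
  refine ⟨Fintype.linearCombination k t, fun p x => ?_⟩
  rw [haug, Ideal.Quotient.eq, mem_stanleyReisnerIdeal_iff hK]
  refine forall₂_congr fun b _ => ?_
  rw [coeff_sub, sub_eq_zero, coeff_sum, Fintype.linearCombination_apply]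
  refine Eq.congr_left (Finset.sum_congr rfl fun j _ => ?_)
  by_cases hj : F.deg 0 j ≤ b
  · rw [coeff_mul_monomial', if_pos hj, componentCoeffs_apply_of_le x hj, smul_eq_mul]
  · rw [coeff_mul_monomial', if_neg hj, componentCoeffs_apply_of_not_le x hj, zero_smul]

open Classical in
theorem card_deg_zero_le (hK : IsLowerSet K) (b : Fin m →₀ ℕ) :
    Fintype.card {j // F.deg 0 j ≤ b} =
      (if b.support ∈ K then 1 else 0) + F.differentialRank b 0 := by
  obtain ⟨ε, hε⟩ := F.exists_linearMap_aug_eq_mk_iff hK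
  have hker : (if b.support ∈ K then LinearMap.ker ε else ⊤) ⊓ coeffsBelow k (F.deg 0) b =
      (coeffsBelow k (F.deg 1) b).map (scalarMap (F.deg 1) (F.deg 0) (F.d 0)) := by
    refine (F.isGradedMap_d 0).inf_coeffsBelow_eq_map_of_exact F.exact_aug
      (W := fun b => if b.support ∈ K then LinearMap.ker ε else ⊤) (fun x => ?_) b
    rw [← map_zero (Ideal.Quotient.mk _), hε]
    refine forall_congr' fun b => ?_
    split_ifs with hb <;> simp [hb]
  rw [differentialRank, ← hker, ← finrank_coeffsBelow (R := k)]
  split_ifs with hb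
  · have hsurj : (coeffsBelow k (F.deg 0) b).map ε = ⊤ := by
      obtain ⟨x, hx⟩ := F.aug_surjective (Ideal.Quotient.mk _ (monomial b 1))
      refine (Ideal.eq_top_iff_one _).2 ⟨_, componentCoeffs_mem_coeffsBelow _ b x, ?_⟩
      rw [(hε _ _).1 hx b hb, coeff_monomial, if_pos rfl]
    rw [← finrank_map_add_finrank_ker_inf ε, hsurj, finrank_top, Module.finrank_self,
      if_pos hb]
  · rw [if_neg hb, top_inf_eq, zero_add]

theorem card_deg_succ_le (b : Fin m →₀ ℕ) (i : ℕ) :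
    Fintype.card {j // F.deg (i + 1) j ≤ b} =
      F.differentialRank b i + F.differentialRank b (i + 1) := by
  have hker := (F.isGradedMap_d (i + 1)).inf_coeffsBelow_eq_map_of_exact (F.exact_d i)
    (F.isGradedMap_d i).eq_zero_iff b
  rw [← finrank_coeffsBelow (R := k),
    ← finrank_map_add_finrank_ker_inf (scalarMap (F.deg (i + 1)) (F.deg i) (F.d i)), hker]
  rfl

open Classical in
theorem sum_neg_one_pow_mul_card_deg_le (hK : IsLowerSet K) (b : Fin m →₀ ℕ) :
    ∑ i ∈ Finset.range (h + 1), (-1) ^ i * (Fintype.card {j // F.deg i j ≤ b} : ℤ) =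
      if b.support ∈ K then 1 else 0 := by
  rw [sum_neg_one_pow_mul_of_telescoping (e := if b.support ∈ K then 1 else 0)
    (ρ := fun i => (F.differentialRank b i : ℤ)), F.differentialRank_length, Nat.cast_zero,
    mul_zero, add_zero]
  · exact_mod_cast F.card_deg_zero_le hK b
  · exact_mod_cast F.card_deg_succ_le b

theorem card_deg_le_squarefreeVec (i : ℕ) (a : Finset (Fin m)) :
    Fintype.card {j // F.deg i j ≤ squarefreeVec a} = ∑ c ∈ a.powerset, F.betti i c := by
  simp only [betti, multigradedBetti, Fintype.card_subtype]
  rw [← Finset.card_biUnion]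
  · congr 1
    ext j
    simp [le_squarefreeVec_iff]
  · refine fun c _ c' _ hne => Finset.disjoint_filter.2 fun j _ hj hj' => hne ?_
    exact squarefreeVec_injective (hj.symm.trans hj')

open Classical in
theorem sum_neg_one_pow_mul_sum_betti (hK : IsLowerSet K) (a : Finset (Fin m)) :
    ∑ i ∈ Finset.range (h + 1), (-1) ^ i * ∑ c ∈ a.powerset, (F.betti i c : ℤ) =
      if a ∈ K then 1 else 0 := by
  simpa only [card_deg_le_squarefreeVec, support_squarefreeVec, Nat.cast_sum] using
    F.sum_neg_one_pow_mul_card_deg_le hK (squarefreeVec a)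

end MinimalFreeResolution

theorem moebiusTransform_moebiusTransform (g : Finset (Fin m) → ZMod 2) :
    moebiusTransform (moebiusTransform g) = g := by
  funext a
  have hswap : moebiusTransform (moebiusTransform g) a =
      ∑ c ∈ a.powerset, ∑ _b ∈ Finset.Icc c a, g c := by
    refine Finset.sum_comm' fun b c => ?_
    simp only [Finset.mem_powerset, Finset.mem_Icc]
    exact ⟨fun h => ⟨⟨h.2, h.1⟩, h.2.trans h.1⟩, fun h => ⟨h.1.2, h.1.1⟩⟩
  rw [hswap, Finset.sum_eq_single_of_mem a (Finset.mem_powerset_self a)]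
  · simp
  · intro c hc hne
    have hca : c ⊂ a := (Finset.mem_powerset.1 hc).ssubset_of_ne hne
    have hcard : a.card - c.card ≠ 0 := (Nat.sub_pos_of_lt (Finset.card_lt_card hca)).ne'
    rw [Finset.sum_const, Finset.card_Icc_finset hca.subset, nsmul_eq_mul, Nat.cast_pow,
      CharP.cast_eq_zero, zero_pow hcard, zero_mul]

theorem moebiusTransform_sum_betti (f : Finset (Fin m) → ZMod 2)
    (hK : IsLowerSet (suppComplex f)) {h : ℕ} (F : MinimalFreeResolution k (suppComplex f) h) :
    moebiusTransform (fun a => ((∑ i ∈ Finset.range (h + 1), F.betti i a : ℕ) : ZMod 2)) = f := by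
  classical
  funext a
  have hcast := congrArg (Int.cast : ℤ → ZMod 2) (F.sum_neg_one_pow_mul_sum_betti hK a)
  have hneg : (-1 : ZMod 2) = 1 := rfl
  have hfa : f a = if a ∈ suppComplex f then 1 else 0 := by
    split_ifs with ha
    · exact ha
    · exact not_not.1 fun h => ha (Fin.eq_one_of_ne_zero (f a) h)
  push_cast at hcast
  simp only [hneg, one_pow, one_mul] at hcast
  rw [hfa, ← hcast, Finset.sum_comm]
  simp only [moebiusTransform, Nat.cast_sum]

theorem moebiusTransform_eq_sum_betti {f : Finset (Fin m) → ZMod 2}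
    (hK : IsLowerSet (suppComplex f)) {h : ℕ} (F : MinimalFreeResolution k (suppComplex f) h)
    (a : Finset (Fin m)) :
    moebiusTransform f a = ((∑ i ∈ Finset.range (h + 1), F.betti i a : ℕ) : ZMod 2) := by
  conv_lhs => rw [← moebiusTransform_sum_betti f hK F, moebiusTransform_moebiusTransform]

end EulerCharacteristic

section Syzygies

/-- Relations of squarefree type among generators placed in degrees `index l`: `relations a` is the
space of relations in degree `a`, and these only involve generators of degree strictly below `a`,
which is what minimality of a presentation amounts to. For `P = Finset (Fin m)`, an element of `P`
stands for the corresponding `0/1` vector of `ℕ^m`. -/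
structure SyzygyFamily (k : Type*) [Field k] (P : Type*) [PartialOrder P] where
  rank : ℕ
  index : Fin rank → P
  relations : P → Submodule k (Fin rank → k)
  relations_mono : Monotone relations
  index_lt : ∀ {a w}, w ∈ relations a → ∀ {l}, w l ≠ 0 → index l < a

namespace SyzygyFamily

variable {k : Type*} [Field k] {P : Type*} [PartialOrder P]

theorem relations_le_coeffsBelow (N : SyzygyFamily k P) (a : P) :
    N.relations a ≤ coeffsBelow k N.index a := fun _ hw =>
  mem_coeffsBelow.2 fun _ hl => not_not.1 fun h0 => hl (N.index_lt hw h0).le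

open Classical in
/-- The presentation of `k(K)` by one generator: in degree `a` it is killed exactly when `a ∉ K`.
It is reducible so that `rank` unfolds to `1`. -/
@[reducible] noncomputable def ofLowerSet (k : Type*) [Field k] [OrderBot P] {K : Set P}
    (hK : IsLowerSet K) (hbot : ⊥ ∈ K) : SyzygyFamily k P where
  rank := 1
  index _ := ⊥
  relations a := if a ∈ K then ⊥ else ⊤
  relations_mono a b hab := by
    by_cases hb : b ∈ K
    · simp only [if_pos hb, if_pos (hK hab hb), le_rfl]
    · simp only [if_neg hb, le_top]
  index_lt {a w} hw l hl := by
    refine bot_lt_iff_ne_bot.2 ?_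
    rintro rfl
    rw [if_pos hbot, Submodule.mem_bot] at hw
    exact hl (congrFun hw l)

variable [Finite P]

theorem exists_next (N : SyzygyFamily k P) :
    ∃ (T : SyzygyFamily k P) (g : Fin T.rank → Fin N.rank → k),
      IsMinimalGenerators N.relations T.index g ∧ ∀ a, T.relations a =
        LinearMap.ker (Fintype.linearCombination k g) ⊓ coeffsBelow k T.index a := by
  obtain ⟨n, s, g, hg⟩ := exists_isMinimalGenerators N.relations_mono
  refine ⟨{
    rank := n
    index := s
    relations := fun a => LinearMap.ker (Fintype.linearCombination k g) ⊓ coeffsBelow k s a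
    relations_mono := fun a b hab => inf_le_inf_left _ (coeffsBelow_mono hab)
    index_lt := fun {a c} hc l hl => ?_ }, g, hg, fun a => rfl⟩
  refine lt_of_le_of_ne (le_of_mem_coeffsBelow hc.2 hl) ?_
  rintro rfl
  exact hl (hg.coeff_eq_zero c hc.1 l hc.2)

/-- The first syzygies of `N`: the relations among minimal generators of `N.relations`. -/
noncomputable def next (N : SyzygyFamily k P) : SyzygyFamily k P := N.exists_next.choose

/-- The minimal generators of `N.relations` in terms of which `N.next` is defined. -/
noncomputable def gens (N : SyzygyFamily k P) : Fin N.next.rank → Fin N.rank → k :=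
  N.exists_next.choose_spec.choose

theorem isMinimalGenerators_gens (N : SyzygyFamily k P) :
    IsMinimalGenerators N.relations N.next.index N.gens :=
  N.exists_next.choose_spec.choose_spec.1

theorem relations_next (N : SyzygyFamily k P) (a : P) : N.next.relations a =
    LinearMap.ker (Fintype.linearCombination k N.gens) ⊓ coeffsBelow k N.next.index a :=
  N.exists_next.choose_spec.choose_spec.2 a

theorem gens_ne_zero (N : SyzygyFamily k P) (j : Fin N.next.rank) : N.gens j ≠ 0 := by
  classical
  intro hj
  have hker : Pi.single j 1 ∈ LinearMap.ker (Fintype.linearCombination k N.gens) := by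
    rw [LinearMap.mem_ker, Fintype.linearCombination_apply_single, hj, smul_zero]
  have hcoeff := N.isMinimalGenerators_gens.coeff_eq_zero _ hker j (single_mem_coeffsBelow le_rfl 1)
  rw [Pi.single_eq_same] at hcoeff
  exact one_ne_zero hcoeff

theorem exists_index_lt_index_next (N : SyzygyFamily k P) (j : Fin N.next.rank) :
    ∃ l, N.index l < N.next.index j := by
  obtain ⟨l, hl⟩ := Function.ne_iff.1 (N.gens_ne_zero j)
  exact ⟨l, N.index_lt (N.isMinimalGenerators_gens.mem j) hl⟩

/-- The `i`-th syzygies of `N`. -/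
noncomputable def iter (N : SyzygyFamily k P) : ℕ → SyzygyFamily k P
  | 0 => N
  | i + 1 => (iter N i).next

theorem le_index_iter (N : SyzygyFamily k P) {r : P → ℕ} (hr : StrictMono r) (i : ℕ) :
    ∀ l, i ≤ r ((N.iter i).index l) := by
  induction i with
  | zero => exact fun _ => Nat.zero_le _
  | succ i ih =>
    intro j
    obtain ⟨l, hl⟩ := (N.iter i).exists_index_lt_index_next j
    exact (ih l).trans_lt (hr hl)

theorem rank_iter_eq_zero (N : SyzygyFamily k P) {r : P → ℕ} (hr : StrictMono r) {i : ℕ}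
    (hi : ∀ a, r a < i) : (N.iter i).rank = 0 :=
  Nat.eq_zero_of_not_pos fun h => (N.le_index_iter hr i ⟨0, h⟩).not_gt (hi _)

end SyzygyFamily

end Syzygies

section Existence

namespace SyzygyFamily

variable {k : Type*} [Field k] {m : ℕ}

/-- The degrees of the generators as elements of `ℕ^m`. -/
noncomputable def deg (N : SyzygyFamily k (Finset (Fin m))) (l : Fin N.rank) : Fin m →₀ ℕ :=
  squarefreeVec (N.index l)

theorem coeffsBelow_deg (N : SyzygyFamily k (Finset (Fin m))) (b : Fin m →₀ ℕ) :
    coeffsBelow k N.deg b = coeffsBelow k N.index b.support := by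
  ext c
  simp only [mem_coeffsBelow, deg, squarefreeVec_le_iff]

/-- The graded map onto the relations of `N` whose matrix, with its monomials dropped, has the
columns `N.gens`. -/
noncomputable def differential (N : SyzygyFamily k (Finset (Fin m))) :
    (Fin N.next.rank → MvPolynomial (Fin m) k) →ₗ[MvPolynomial (Fin m) k]
      (Fin N.rank → MvPolynomial (Fin m) k) :=
  Fintype.linearCombination (MvPolynomial (Fin m) k)
    fun j => ofComponentCoeffs N.deg (N.next.deg j) (N.gens j)

variable (N : SyzygyFamily k (Finset (Fin m)))

theorem differential_single (j : Fin N.next.rank) :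
    N.differential (Pi.single j 1) = ofComponentCoeffs N.deg (N.next.deg j) (N.gens j) := by
  rw [differential, Fintype.linearCombination_apply_single, one_smul]

theorem isGradedMap_differential : IsGradedMap N.next.deg N.deg N.differential :=
  isGradedMap_of_single_mem fun j =>
    N.differential_single j ▸ ofComponentCoeffs_mem_freePiece N.deg _ _

theorem scalarMap_differential :
    scalarMap N.next.deg N.deg N.differential = Fintype.linearCombination k N.gens := by
  refine congrArg _ (funext fun j => ?_)
  rw [differential_single, componentCoeffs_ofComponentCoeffs]
  rw [coeffsBelow_deg, deg, support_squarefreeVec]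
  exact N.relations_le_coeffsBelow _ (N.isMinimalGenerators_gens.mem j)

theorem differential_eq_zero_iff (x : Fin N.next.rank → MvPolynomial (Fin m) k) :
    N.differential x = 0 ↔
      ∀ b, componentCoeffs N.next.deg b x ∈ N.next.relations b.support := by
  rw [N.isGradedMap_differential.eq_zero_iff, scalarMap_differential]
  refine forall_congr' fun b => ?_
  rw [relations_next, ← coeffsBelow_deg, Submodule.mem_inf,
    and_iff_left (componentCoeffs_mem_coeffsBelow N.next.deg b x)]

theorem mem_range_differential_iff (y : Fin N.rank → MvPolynomial (Fin m) k) :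
    y ∈ Set.range N.differential ↔ ∀ b, componentCoeffs N.deg b y ∈ N.relations b.support := by
  simp only [N.isGradedMap_differential.mem_range_iff, scalarMap_differential, coeffsBelow_deg,
    N.isMinimalGenerators_gens.map_eq]

theorem differential_apply_mem (x : Fin N.next.rank → MvPolynomial (Fin m) k) (l : Fin N.rank) :
    N.differential x l ∈ Ideal.span (Set.range (X : Fin m → MvPolynomial (Fin m) k)) := by
  rw [← Set.image_univ, mem_ideal_span_X_image]
  intro c hc
  rw [mem_support_iff, ← componentCoeffs_add_deg N.deg c (N.differential x) l] at hc
  have hlt := N.index_lt ((N.mem_range_differential_iff _).1 ⟨x, rfl⟩ _) hc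
  by_contra! hzero
  obtain rfl : c = 0 := Finsupp.ext fun i => hzero i (Set.mem_univ i)
  rw [zero_add, deg, support_squarefreeVec] at hlt
  exact hlt.ne rfl

end SyzygyFamily

variable (k : Type*) [Field k] {m : ℕ} {K : Set (Finset (Fin m))}

/-- The projection `k[v] → k(K)`, defined on `F₀ = k[v]` written as a module of functions on
`Fin 1`. -/
noncomputable def faceRingAug (K : Set (Finset (Fin m))) :
    (Fin 1 → MvPolynomial (Fin m) k) →ₗ[MvPolynomial (Fin m) k] FaceRing k K :=
  (stanleyReisnerIdeal k K).mkQ ∘ₗ LinearMap.proj 0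

theorem deg_ofLowerSet (hK : IsLowerSet K) (hempty : ∅ ∈ K) :
    (SyzygyFamily.ofLowerSet k hK hempty).deg = 0 :=
  funext fun _ => Finset.sum_empty (f := fun i => Finsupp.single i 1)

theorem faceRingAug_eq_zero_iff (hK : IsLowerSet K) (hempty : ∅ ∈ K)
    (x : Fin 1 → MvPolynomial (Fin m) k) :
    faceRingAug k K x = 0 ↔ ∀ b, componentCoeffs (SyzygyFamily.ofLowerSet k hK hempty).deg b x ∈
      (SyzygyFamily.ofLowerSet k hK hempty).relations b.support := by
  change Ideal.Quotient.mk _ (x 0) = 0 ↔ _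
  rw [Ideal.Quotient.eq_zero_iff_mem, mem_stanleyReisnerIdeal_iff hK, deg_ofLowerSet]
  refine forall_congr' fun b => ?_
  have hcoeff : componentCoeffs (0 : Fin 1 → Fin m →₀ ℕ) b x = 0 ↔ coeff b (x 0) = 0 := by
    rw [funext_iff, Fin.forall_fin_one, componentCoeffs_apply_of_le x zero_le, Pi.zero_apply,
      tsub_zero, Pi.zero_apply]
  by_cases hb : b.support ∈ K
  · simpa [hb] using hcoeff.symm
  · simp [hb]

theorem exists_minimalFreeResolution (hK : IsLowerSet K) (hempty : ∅ ∈ K) :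
    ∃ h : ℕ, Nonempty (MinimalFreeResolution k K h) := by
  let N := (SyzygyFamily.ofLowerSet k hK hempty).iter
  have hne : {i | (N i).rank ≠ 0}.Nonempty := ⟨0, one_ne_zero⟩
  have hbdd : BddAbove {i | (N i).rank ≠ 0} := by
    refine ⟨m, fun i hi => not_lt.1 fun hmi => hi ?_⟩
    refine SyzygyFamily.rank_iter_eq_zero _ Finset.card_strictMono fun a => ?_
    exact (Finset.card_le_univ a).trans_lt (by rwa [Fintype.card_fin])
  refine ⟨sSup {i | (N i).rank ≠ 0}, ⟨{
    rank := fun i => (N i).rank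
    deg := fun i => (N i).deg
    aug := faceRingAug k K
    d := fun i => (N i).differential
    aug_graded := fun b x hx => ⟨_, ?_, rfl⟩
    d_graded := fun i => (N i).isGradedMap_differential
    aug_surjective := (Submodule.mkQ_surjective _).comp (Function.surjective_eval (0 : Fin 1))
    exact_aug := fun y => (faceRingAug_eq_zero_iff k hK hempty y).trans
      ((N 0).mem_range_differential_iff y).symm
    exact_d := fun i y => ((N i).differential_eq_zero_iff y).trans
      ((N (i + 1)).mem_range_differential_iff y).symm
    minimal := fun i => (N i).differential_apply_mem
    rank_length := Nat.sSup_mem hne hbdd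
    rank_of_length_lt := fun i hi => not_not.1 (notMem_of_csSup_lt hi hbdd) }⟩⟩
  have hx0 := hx (0 : Fin 1)
  rwa [show (N 0).deg = 0 from deg_ofLowerSet k hK hempty] at hx0

end Existence

theorem theorem1p1_general (k : Type*) [Field k] (m : ℕ) (f : Finset (Fin m) → ZMod 2)
    (hf : IsLowerSet (suppComplex f)) (hne : (suppComplex f).Nonempty) :
    (∃ h : ℕ, Nonempty (MinimalFreeResolution k (suppComplex f) h)) ∧
    ∀ (h : ℕ) (F : MinimalFreeResolution k (suppComplex f) h),
      moebiusTransform f =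
          ∑ i ∈ Finset.range (h + 1), ∑ a : Finset (Fin m), (F.betti i a : ZMod 2) • deltaFun a ∧
      ∀ a : Finset (Fin m),
        moebiusTransform f a = ((∑ i ∈ Finset.range (h + 1), F.betti i a : ℕ) : ZMod 2) := by
  refine ⟨exists_minimalFreeResolution k hf (hf.bot_mem.2 hne), fun h F =>
    ⟨funext fun b => ?_, moebiusTransform_eq_sum_betti hf F⟩⟩
  rw [moebiusTransform_eq_sum_betti hf F b]
  simp [Finset.sum_apply, deltaFun]

theorem theorem1p1 (k : Type*) [Field k] (m : ℕ) (hm : 0 < m)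
    (f : Finset (Fin m) → ZMod 2) (hf : IsSimplicialComplexOn (suppComplex f)) :
    (∃ h : ℕ, Nonempty (MinimalFreeResolution k (suppComplex f) h)) ∧
    ∀ (h : ℕ) (F : MinimalFreeResolution k (suppComplex f) h),
      moebiusTransform f =
          ∑ i ∈ Finset.range (h + 1), ∑ a : Finset (Fin m), (F.betti i a : ZMod 2) • deltaFun a ∧
      ∀ a : Finset (Fin m),
        moebiusTransform f a = ((∑ i ∈ Finset.range (h + 1), F.betti i a : ℕ) : ZMod 2) := by
  obtain ⟨a, ha, -⟩ := hf.vertex_set ⟨0, hm⟩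
  exact theorem1p1_general k m f (fun a b hba ha => hf.down_closed a ha b hba) ⟨a, ha⟩
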